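/- **Setting.** There are $n$ players and $n$ items. A preference profile $\sigma$ gives each player $i$ a strict total order of the items, with $O_i(k)$ the $k$-th favourite item of $i$. For $p,q\in\mathbb R^{n}$ indexed by items, write $p\succeq_i q$ if $\sum_{k\le j}p(O_i(k))\ge\sum_{k\le j}q(O_i(k))$ for all $j\in\{1,\dots,n\}$. A *mechanism* maps every profile to a probability distribution on assignments (bijections from players to items); such a distribution $\rho$ induces the bistochastic matrix $P$ with $P(i,j)=\Pr_{\rho}[\,i\text{ receives }j\,]$. A bistochastic matrix $P$ is *ordinally efficient* for $\sigma$ if there is no bistochastic $P'\ne P$ with $P'_i\succeq_i P_i$ for all $i$. It has *strong equal treatment* for $\sigma$ if, for all players $i,j$ and all $\ell\le n$, whenever $O_i(k)=O_j(k)$ for all $k\le\ell$, then $P(i,O_i(k))=P(j,O_j(k))$ for all $k\le\ell$. A mechanism has one of these properties if its induced matrix has it for every profile. The *probabilistic serial (PS)* matrix of $\sigma$ is obtained by letting all players simultaneously consume, at unit rate, their favourite item that is not yet totally consumed (each item having size $1$) until everything is consumed; $P(i,j)$ is the amount of $j$ consumed by $i$. A *PS mechanism* is a mechanism that induces the PS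 matrix for every profile. **Protocols.** The profile is publicly known (or declared) beforehand. In a *bounded-round protocol*, given the profile, the players proceed in a bounded number of synchronous rounds over a broadcast channel; in each round every player, using fresh private discrete randomness, its private internal state and all earlier messages, updates its state and broadcasts a message, and at the end a public deterministic function of the transcript gives an assignment. A *fail-stop adversary* controls a set of corrupted players; in each round it sees the internal states of the corrupted players and all messages of this and earlier rounds (including those of the honest players in the current round), and it may only make corrupted players stop sending messages, from the current round on. For a given profile, a protocol is *maximin secure* against a class of adversaries if, for every adversary of the class and every non-corrupted player $i$, the item distributions of $i$ satisfy $\mathbb E[Q_i]\succeq_i\mathbb E[P_i]$, where $Q$ is the assignment under the adversary and $P$ the assignment when all players are honest; it is maximin secure if this holds for every profile. It *realizes* a mechanism if for every profile its honest execution has the distribution given by the mechanism. **Theorem.** Let $n\ge 4$ and let $t\ge n/2$ be an integer. 1. No mechanism that has both ordinal efficiency and strong equal treatment can be realized by a bounded-round protocol that is maximin secure against fail-stop adversaries controlling at most $t$ players. 2. No PS mechanism can be realized by a bounded-round protocol that is maximin secure against fail-stop adversaries controlling at most $t$ players. 3. A single instance suffices for (1): there is a profile $\sigma$ of the $n$ players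 such that no bounded-round protocol whose honest execution on $\sigma$ induces a matrix that is ordinally efficient and has strong equal treatment for $\sigma$ is maximin secure for $\sigma$ against fail-stop adversaries controlling at most $t$ players. -/

import Mathlib

universe u

/-! ### Preferences, bistochastic matrices, mechanisms -/

/-- A preference profile of `n` players on `n` items: `σ i k` is the `k`-th favourite item of
player `i` (ranks are counted from `0`). -/
abbrev Profile (n : ℕ) : Type := Fin n → Equiv.Perm (Fin n)

/-- A (deterministic) assignment: `a i` is the item that player `i` receives. -/
abbrev Assignment (n : ℕ) : Type := Equiv.Perm (Fin n)

/-- Vector dominance `p ⪰ q` with respect to the favourite function `o`. -/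
def VecDominates {n : ℕ} (o : Equiv.Perm (Fin n)) (p q : Fin n → ℝ) : Prop :=
  ∀ j : Fin n, ∑ k ∈ Finset.Iic j, q (o k) ≤ ∑ k ∈ Finset.Iic j, p (o k)

/-- Matrix dominance `P ⪰ Q` with respect to the profile `σ`. -/
def MatDominates {n : ℕ} (σ : Profile n) (P Q : Matrix (Fin n) (Fin n) ℝ) : Prop :=
  ∀ i, VecDominates (σ i) (P i) (Q i)

/-- Ordinal efficiency of a bistochastic matrix: no other bistochastic matrix dominates it. -/
def OrdEfficient {n : ℕ} (σ : Profile n) (P : Matrix (Fin n) (Fin n) ℝ) : Prop :=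
  P ∈ doublyStochastic ℝ (Fin n) ∧
    ¬ ∃ Q ∈ doublyStochastic ℝ (Fin n), Q ≠ P ∧ MatDominates σ Q P

/-- Strong equal treatment: players whose top items up to rank `l` agree receive each of those
items with the same probability. -/
def StrongEqualTreat {n : ℕ} (σ : Profile n) (P : Matrix (Fin n) (Fin n) ℝ) : Prop :=
  ∀ i j l : Fin n, (∀ k ≤ l, σ i k = σ j k) → ∀ k ≤ l, P i (σ i k) = P j (σ j k)

/-- The bistochastic matrix `∑ₐ ρ(a) · a` induced by a distribution `ρ` on assignments. -/
noncomputable def inducedMatrix {n : ℕ} (ρ : PMF (Assignment n)) : Matrix (Fin n) (Fin n) ℝ :=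
  ∑ a : Assignment n, (ρ a).toReal • a.permMatrix ℝ

/-- A mechanism maps a preference profile to a distribution on assignments. -/
abbrev Mechanism (n : ℕ) : Type := Profile n → PMF (Assignment n)

/-- A mechanism is ordinally efficient if all its induced matrices are. -/
def Mechanism.OrdinallyEfficient {n : ℕ} (F : Mechanism n) : Prop :=
  ∀ σ, OrdEfficient σ (inducedMatrix (F σ))

/-- A mechanism has strong equal treatment if all its induced matrices do. -/
def Mechanism.StrongEqualTreatment {n : ℕ} (F : Mechanism n) : Prop :=
  ∀ σ, StrongEqualTreat σ (inducedMatrix (F σ))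

/-! ### The probabilistic serial mechanism (simultaneous eating at unit rate) -/

/-- The amount of item `j` that is left when player `i` has consumed `P i j` of it. -/
def psLeft {n : ℕ} (P : Matrix (Fin n) (Fin n) ℚ) (j : Fin n) : ℚ := 1 - ∑ i, P i j

/-- Given the consumption `P` so far, `j` is the favourite remaining item of player `i`. -/
def PsEats {n : ℕ} (σ : Profile n) (P : Matrix (Fin n) (Fin n) ℚ) (i j : Fin n) : Prop :=
  0 < psLeft P j ∧ ∀ j', 0 < psLeft P j' → (σ i).symm j ≤ (σ i).symm j'

instance {n : ℕ} (σ : Profile n) (P : Matrix (Fin n) (Fin n) ℚ) (i j : Fin n) :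
    Decidable (PsEats σ P i j) := by
  unfold PsEats; infer_instance

/-- The players that are currently consuming item `j`. -/
def psEaters {n : ℕ} (σ : Profile n) (P : Matrix (Fin n) (Fin n) ℚ) (j : Fin n) :
    Finset (Fin n) :=
  Finset.univ.filter fun i => PsEats σ P i j

/-- The items that somebody is currently consuming. -/
def psActive {n : ℕ} (σ : Profile n) (P : Matrix (Fin n) (Fin n) ℚ) : Finset (Fin n) :=
  Finset.univ.filter fun j => (psEaters σ P j).Nonempty

/-- The time until the next item is totally consumed (`0` if nothing is left). -/
def psTime {n : ℕ} (σ : Profile n) (P : Matrix (Fin n) (Fin n) ℚ) : ℚ :=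
  if h : (psActive σ P).Nonempty then
    (psActive σ P).inf' h fun j => psLeft P j / (psEaters σ P j).card
  else 0

/-- Everybody consumes its favourite remaining item at unit rate until the next item is used up. -/
def psStep {n : ℕ} (σ : Profile n) (P : Matrix (Fin n) (Fin n) ℚ) : Matrix (Fin n) (Fin n) ℚ :=
  fun i j => P i j + if PsEats σ P i j then psTime σ P else 0

/-- The matrix of the probabilistic serial mechanism. Every phase uses up at least one item, so
everything is consumed after `n` phases. -/
def psMatrix {n : ℕ} (σ : Profile n) : Matrix (Fin n) (Fin n) ℝ :=
  ((psStep σ)^[n] 0).map (fun x : ℚ => (x : ℝ))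

/-- `F` is a probabilistic serial mechanism: it samples, for every profile, an assignment from some
distribution that induces the probabilistic serial matrix. -/
def Mechanism.IsPS {n : ℕ} (F : Mechanism n) : Prop :=
  ∀ σ, inducedMatrix (F σ) = psMatrix σ

/-! ### Independent sampling -/

theorem tsum_prod_pmf : ∀ {n : ℕ} {α : Fin n → Type u} (p : ∀ i, PMF (α i)),
    ∑' f : (∀ i, α i), ∏ i, p i (f i) = 1 := by
  intro n
  induction n with
  | zero => intro α p; simp [tsum_fintype]
  | succ n ih =>
    intro α p
    rw [← (Fin.consEquiv α).tsum_eq, ENNReal.tsum_prod']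
    simp only [Fin.consEquiv, Equiv.coe_fn_mk, Fin.prod_univ_succ, Fin.cons_zero, Fin.cons_succ]
    simp only [ENNReal.tsum_mul_left, ih fun i => p i.succ, mul_one, PMF.tsum_coe]

/-- The joint distribution of independent samples, one from each `p i`. -/
noncomputable def pmfPi {n : ℕ} {α : Fin n → Type u} (p : ∀ i, PMF (α i)) : PMF (∀ i, α i) :=
  ⟨fun f => ∏ i, p i (f i), by
    rw [← tsum_prod_pmf p]; exact ENNReal.summable.hasSum⟩

/-! ### Broadcast protocols with a bounded number of rounds -/

/-- What appears on the broadcast channel in one round: the message of each player, or `none` if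
the player has stopped. -/
abbrev RoundMsgs (n : ℕ) (Msg : Type u) : Type u := Fin n → Option Msg

/-- A synchronous broadcast protocol for `n` players, for one fixed publicly known profile, that
ends after at most `rounds` rounds (a run that finishes earlier is padded with rounds that
`output` ignores). In every round each player draws, with fresh private randomness, a new internal
state and a message, from its own internal state and all earlier messages. A public deterministic
function of the transcript gives the assignment. Transcripts list the latest round first. -/
structure Session (n : ℕ) where
  /-- bound on the number of rounds -/
  rounds : ℕ
  /-- internal states of the players, not seen by the others -/
  State : Fin n → Type u
  /-- messages -/
  Msg : Type u
  /-- internal states at the beginning -/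
  init : ∀ i, State i
  /-- the programs of the players -/
  step : ∀ i, State i → List (RoundMsgs n Msg) → PMF (State i × Msg)
  /-- the assignment determined by the transcript -/
  output : List (RoundMsgs n Msg) → Assignment n

namespace Session

variable {n : ℕ}

/-- What the programs of all players produce in one round. -/
abbrev Draw (S : Session.{u} n) : Type u := ∀ i, S.State i × S.Msg

/-- What an adversary sees of one round: the messages of all players (it is rushing) and the
internal states of the corrupted players. -/
abbrev Obs (S : Session.{u} n) : Type u := ∀ i, Option (S.State i) × S.Msg

/-- The part of a round that is visible to an adversary that controls the players in `C`. -/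
def observe (S : Session.{u} n) (C : Finset (Fin n)) (d : S.Draw) : S.Obs :=
  fun i => (if i ∈ C then some (d i).1 else none, (d i).2)

/-- A rushing fail-stop adversary. In every round it sees all that it observed in this and in the
earlier rounds (latest round first), and names players that shall stop before their message of this
round is sent; this has an effect on corrupted players only. It need not toss coins: a
randomized strategy is a mixture of such strategies. -/
structure FailStop (S : Session.{u} n) where
  /-- the corrupted players -/
  corrupted : Finset (Fin n)
  /-- the players told to stop in the current round -/
  abort : List S.Obs → Finset (Fin n)

/-- A snapshot of an execution between two rounds. -/
structure Config (S : Session.{u} n) where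
  /-- current internal states -/
  state : ∀ i, S.State i
  /-- players that have stopped -/
  stopped : Finset (Fin n)
  /-- observations of the adversary so far -/
  view : List S.Obs
  /-- public transcript so far -/
  transcript : List (RoundMsgs n S.Msg)

/-- The configuration before the first round. -/
def Config.start (S : Session.{u} n) : S.Config := ⟨S.init, ∅, [], []⟩

/-- One round under the adversary `A`, when the programs produce `d`. A player that has stopped
sends nothing from then on. -/
def Config.next {S : Session.{u} n} (A : S.FailStop) (c : S.Config) (d : S.Draw) : S.Config :=
  let view := S.observe A.corrupted d :: c.view
  let stopped := c.stopped ∪ (A.abort view ∩ A.corrupted)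
  { state := fun i => (d i).1
    stopped := stopped
    view := view
    transcript := (fun i => if i ∈ stopped then none else some (d i).2) :: c.transcript }

/-- The distribution of the configuration after `r` rounds under the adversary `A`; the players
draw independently. -/
noncomputable def run (S : Session.{u} n) (A : S.FailStop) : ℕ → PMF S.Config
  | 0 => PMF.pure (Config.start S)
  | r + 1 => (S.run A r).bind fun c =>
      (pmfPi fun i => S.step i (c.state i) c.transcript).map (c.next A)

/-- The distribution of the assignment under the adversary `A`. -/
noncomputable def outcome (S : Session.{u} n) (A : S.FailStop) : PMF (Assignment n) :=
  (S.run A S.rounds).map fun c => S.output c.transcript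

/-- The distribution of the assignment when all players are honest. -/
noncomputable def honest (S : Session.{u} n) : PMF (Assignment n) :=
  S.outcome { corrupted := ∅, abort := fun _ => ∅ }

/-- Maximin security for the profile `σ` against fail-stop adversaries that control at most `t`
players: every honest player is at least as well off as in the honest execution. -/
def MaximinSecure (S : Session.{u} n) (σ : Profile n) (t : ℕ) : Prop :=
  ∀ A : S.FailStop, A.corrupted.card ≤ t → ∀ i ∉ A.corrupted,
    VecDominates (σ i) (inducedMatrix (S.outcome A) i) (inducedMatrix S.honest i)

end Session

/-- A bounded-round protocol: for every publicly known (or declared) profile, what the players are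
to do. -/
abbrev Protocol (n : ℕ) : Type (u + 1) := Profile n → Session.{u} n

/-- A protocol realizes a mechanism if its honest execution has the same distribution of
assignments, for every profile. -/
def Protocol.Realizes {n : ℕ} (prot : Protocol.{u} n) (F : Mechanism n) : Prop :=
  ∀ σ, (prot σ).honest = F σ

/-- Maximin security of a protocol, for every profile, against fail-stop adversaries that control
at most `t` players. -/
def Protocol.MaximinSecure {n : ℕ} (prot : Protocol.{u} n) (t : ℕ) : Prop :=
  ∀ σ, (prot σ).MaximinSecure σ t

/-! Everything reduces to one profile, `conflictProfile`, and one split of the players into `C`,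
containing `0` and `1`, and `Cᶜ`, containing `2` and `3`, each of size at most `t`.

On this profile, ordinal efficiency with strong equal treatment, and likewise PS, forces
`IsConflictMatrix`: each of the four players gets each of its two favourite items with probability
`1/2`. Then `a 0 = 0` forces `a 1 = 2`, which forces `a 3 = 3`, so the indicators φ of `a 0 = 0` and
ψ of `a 3 = 3` satisfy E[φψ] = 1/2.

Security forces E[φψ] = 1/4 instead. Neither `0` nor `1` may lose any share of item `0`, and
together they cannot exceed 1, so a coalition `Cᶜ` cannot move E[φ] in either direction; likewise
`C` cannot move E[ψ] (`Session.MaximinSecure.unbiasable`). Such events are uncorrelated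
(`Session.expect_mul_of_unbiasable`). To see this, let X_k be the expectation of φ if `Cᶜ` falls
silent after k honest rounds, and Y_k that of ψ if `C` does. X_k is known to `C` and Y_k to `Cᶜ`.
Let X' and Y' be the values if the silence already covers the last of k+1 rounds. As `Cᶜ` may time
its abort by Y_{k+1}, unbiasability gives E[X_{k+1} Y_{k+1}] = E[X' Y_{k+1}]; as `C` knows X', this
equals E[X' Y']. Given the first k rounds, X' and Y' depend on independent draws of the two sides
and have means X_k and Y_k. So E[X_k Y_k] does not depend on k. It is E[φ]E[ψ] at the start and
E[φψ] at the end. -/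

open scoped ENNReal

/-! ### Expectations of nonnegative functions on discrete distributions -/

/-- The expectation of a nonnegative function. -/
noncomputable def PMF.expect {α : Type*} (p : PMF α) (f : α → ℝ≥0∞) : ℝ≥0∞ := ∑' a, p a * f a

namespace PMF

variable {α β : Type*}

theorem expect_pure (a : α) (f : α → ℝ≥0∞) : (PMF.pure a).expect f = f a := by
  classical
  rw [expect, tsum_eq_single a]
  · simp
  · intro b hb
    simp [hb]

theorem expect_bind (p : PMF α) (q : α → PMF β) (f : β → ℝ≥0∞) :
    (p.bind q).expect f = p.expect fun a => (q a).expect f := by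
  simp only [expect, bind_apply, ← ENNReal.tsum_mul_left, ← ENNReal.tsum_mul_right]
  rw [ENNReal.tsum_comm]
  simp only [mul_assoc]

theorem expect_map (p : PMF α) (g : α → β) (f : β → ℝ≥0∞) :
    (p.map g).expect f = p.expect fun a => f (g a) := by
  simp [← bind_pure_comp, expect_bind, expect_pure, Function.comp_def]

theorem expect_add (p : PMF α) (f g : α → ℝ≥0∞) :
    (p.expect fun a => f a + g a) = p.expect f + p.expect g := by
  simp only [expect, mul_add, ENNReal.tsum_add]

theorem expect_const_mul (p : PMF α) (c : ℝ≥0∞) (f : α → ℝ≥0∞) :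
    (p.expect fun a => c * f a) = c * p.expect f := by
  simp only [expect, ← ENNReal.tsum_mul_left, mul_left_comm]

theorem expect_mono (p : PMF α) {f g : α → ℝ≥0∞} (h : ∀ a, f a ≤ g a) :
    p.expect f ≤ p.expect g :=
  ENNReal.tsum_le_tsum fun a => mul_le_mul_right (h a) _

theorem expect_one (p : PMF α) : (p.expect fun _ => 1) = 1 := by
  simp [expect]

theorem expect_congr (p : PMF α) {f g : α → ℝ≥0∞} (h : ∀ a, p a ≠ 0 → f a = g a) :
    p.expect f = p.expect g := by
  refine tsum_congr fun a => ?_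
  by_cases ha : p a = 0
  · simp [ha]
  · rw [h a ha]

/-- Two functions with the same expectation on every fibre of `g` have the same expectation
after weighting by any function of `g`. -/
theorem expect_mul_eq_of_fiber (p : PMF α) (g : α → β) (f₁ f₂ : α → ℝ≥0∞)
    (h : ∀ v, p.expect ({a | g a = v}.indicator f₁) = p.expect ({a | g a = v}.indicator f₂))
    (w : β → ℝ≥0∞) :
    (p.expect fun a => w (g a) * f₁ a) = p.expect fun a => w (g a) * f₂ a := by
  have key (f : α → ℝ≥0∞) : (p.expect fun a => w (g a) * f a) =
      ∑' v, w v * p.expect ({a | g a = v}.indicator f) := by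
    classical
    simp only [expect, ← ENNReal.tsum_mul_left]
    rw [ENNReal.tsum_comm]
    refine tsum_congr fun a => ?_
    rw [tsum_eq_single (g a)]
    · simp [mul_left_comm]
    · intro v hv
      simp [hv.symm]
  rw [key, key]
  exact tsum_congr fun v => by rw [h v]

end PMF

/-! ### Independence of the coordinates of a product distribution -/

theorem tsum_prod_pmf_fintype {ι : Type*} [Fintype ι] {α : ι → Type u} (p : ∀ i, PMF (α i)) :
    ∑' f : (∀ i, α i), ∏ i, p i (f i) = 1 := by
  let e := (Fintype.equivFin ι).symm
  rw [← (Equiv.piCongrLeft α e).tsum_eq, ← tsum_prod_pmf fun k => p (e k)]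
  refine tsum_congr fun f => ?_
  rw [← e.prod_comp]
  simp only [Equiv.piCongrLeft_apply_apply]

section Independence

variable {n : ℕ} {α : Fin n → Type u}

/-- Restriction of a tuple to a set of coordinates. -/
def coordRestrict (C : Finset (Fin n)) (d : ∀ i, α i) : ∀ i : {i // i ∈ C}, α i := fun i => d i

/-- This is Fubini for the splitting of the coordinates into `C` and its complement; both
independence statements below are read off from it. -/
theorem expect_pmfPi_mul (p : ∀ i, PMF (α i)) (C : Finset (Fin n))
    (f : (∀ i : {i // i ∈ C}, α i) → ℝ≥0∞) (g : (∀ i : {i // i ∉ C}, α i) → ℝ≥0∞) :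
    ((pmfPi p).expect fun d => f (coordRestrict C d) * g fun i => d i) =
      (∑' x, (∏ i, p i.1 (x i)) * f x) * ∑' y, (∏ i, p i.1 (y i)) * g y := by
  rw [PMF.expect, ← (Equiv.piEquivPiSubtypeProd (· ∈ C) α).symm.tsum_eq, ENNReal.tsum_prod']
  rw [← ENNReal.tsum_mul_right]
  refine tsum_congr fun x => ?_
  rw [← ENNReal.tsum_mul_left]
  refine tsum_congr fun y => ?_
  have hx : coordRestrict C ((Equiv.piEquivPiSubtypeProd (· ∈ C) α).symm (x, y)) = x := by
    funext i
    simp [coordRestrict, Equiv.piEquivPiSubtypeProd]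
  have hy : (fun i : {i // i ∉ C} =>
      (Equiv.piEquivPiSubtypeProd (· ∈ C) α).symm (x, y) i) = y := by
    funext i
    simp [Equiv.piEquivPiSubtypeProd, i.2]
  rw [hx, hy]
  have : pmfPi p ((Equiv.piEquivPiSubtypeProd (· ∈ C) α).symm (x, y)) =
      (∏ i, p i.1 (x i)) * ∏ i, p i.1 (y i) := by
    change ∏ i, p i _ = _
    rw [← Fintype.prod_subtype_mul_prod_subtype (· ∈ C)]
    congr 1
    · exact Finset.prod_congr (by ext; simp) fun i _ => by
        rw [show (Equiv.piEquivPiSubtypeProd (· ∈ C) α).symm (x, y) i = x i from congrFun hx i]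
    · exact Finset.prod_congr (by ext; simp) fun i _ => by
        rw [show (Equiv.piEquivPiSubtypeProd (· ∈ C) α).symm (x, y) i = y i from congrFun hy i]
  rw [this]
  ring

/-- The expectation of a function of the coordinates outside `C` does not depend on the
distributions of the coordinates in `C`. -/
theorem expect_pmfPi_congr (p q : ∀ i, PMF (α i)) (C : Finset (Fin n))
    (hpq : ∀ i ∉ C, p i = q i) {F : (∀ i, α i) → ℝ≥0∞}
    (hF : ∀ d d' : ∀ i, α i, (∀ i ∉ C, d i = d' i) → F d = F d') :
    (pmfPi p).expect F = (pmfPi q).expect F := by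
  have hfac : F.FactorsThrough (fun (d : ∀ i, α i) (i : {i // i ∉ C}) => d i) := by
    intro d d' h
    exact hF d d' fun i hi => congrFun h ⟨i, hi⟩
  obtain ⟨g, rfl⟩ := (Function.factorsThrough_iff _).1 hfac
  have hp := expect_pmfPi_mul p C (fun _ => 1) g
  have hq := expect_pmfPi_mul q C (fun _ => 1) g
  simp only [one_mul, mul_one] at hp hq
  rw [tsum_prod_pmf_fintype (fun i : {i // i ∈ C} => p i.1), one_mul] at hp
  rw [tsum_prod_pmf_fintype (fun i : {i // i ∈ C} => q i.1), one_mul] at hq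
  refine hp.trans (Eq.trans ?_ hq.symm)
  refine tsum_congr fun y => ?_
  congr 1
  exact Finset.prod_congr rfl fun i _ => by rw [hpq i.1 i.2]

/-- Functions of disjoint sets of coordinates are independent. -/
theorem expect_pmfPi_mul_of_indep (p : ∀ i, PMF (α i)) (C : Finset (Fin n))
    {F G : (∀ i, α i) → ℝ≥0∞}
    (hF : ∀ d d' : ∀ i, α i, (∀ i ∈ C, d i = d' i) → F d = F d')
    (hG : ∀ d d' : ∀ i, α i, (∀ i ∉ C, d i = d' i) → G d = G d') :
    ((pmfPi p).expect fun d => F d * G d) = (pmfPi p).expect F * (pmfPi p).expect G := by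
  have hF' : F.FactorsThrough (coordRestrict C) := fun d d' h =>
    hF d d' fun i hi => congrFun h ⟨i, hi⟩
  have hG' : G.FactorsThrough (fun (d : ∀ i, α i) (i : {i // i ∉ C}) => d i) := fun d d' h =>
    hG d d' fun i hi => congrFun h ⟨i, hi⟩
  obtain ⟨f, rfl⟩ := (Function.factorsThrough_iff _).1 hF'
  obtain ⟨g, rfl⟩ := (Function.factorsThrough_iff _).1 hG'
  have h₁ := expect_pmfPi_mul p C f (fun _ => 1)
  have h₂ := expect_pmfPi_mul p C (fun _ => 1) g
  simp only [one_mul, mul_one] at h₁ h₂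
  rw [tsum_prod_pmf_fintype (fun i : {i // i ∉ C} => p i.1), mul_one] at h₁
  rw [tsum_prod_pmf_fintype (fun i : {i // i ∈ C} => p i.1), one_mul] at h₂
  have h₃ := expect_pmfPi_mul p C f g
  rw [← h₁, ← h₂] at h₃
  exact h₃

end Independence

namespace Session

variable {n : ℕ}

/-! ### Continuation values and honest histories -/

/-- What appears on the channel in one round if the players in `C` are silent. -/
def maskedMsgs (S : Session.{u} n) (C : Finset (Fin n)) (d : S.Draw) : RoundMsgs n S.Msg :=
  fun i => if i ∈ C then none else some (d i).2

theorem maskedMsgs_empty (S : Session.{u} n) (d : S.Draw) :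
    S.maskedMsgs ∅ d = fun i => some (d i).2 := by
  funext i
  simp [maskedMsgs]

/-- The joint distribution of what the programs of all players produce in the next round. -/
noncomputable def drawLaw (S : Session.{u} n) (s : ∀ i, S.State i)
    (τ : List (RoundMsgs n S.Msg)) : PMF S.Draw :=
  pmfPi fun i => S.step i (s i) τ

/-- The expectation of `φ` of the assignment if there are `m` more rounds, in which the players
in `C` are silent. -/
noncomputable def value (S : Session.{u} n) (C : Finset (Fin n)) (φ : Assignment n → ℝ≥0∞) :
    ℕ → (∀ i, S.State i) → List (RoundMsgs n S.Msg) → ℝ≥0∞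
  | 0, _, τ => φ (S.output τ)
  | m + 1, s, τ => (S.drawLaw s τ).expect fun d =>
      S.value C φ m (fun i => (d i).1) (S.maskedMsgs C d :: τ)

/-- The expectation of `φ` of the assignment if there are `m` more rounds under the
adversary `A`. -/
noncomputable def advValue (S : Session.{u} n) (A : S.FailStop) (φ : Assignment n → ℝ≥0∞) :
    ℕ → S.Config → ℝ≥0∞
  | 0, c => φ (S.output c.transcript)
  | m + 1, c => (S.drawLaw c.state c.transcript).expect fun d => S.advValue A φ m (c.next A d)

/-- Backward induction and forward simulation agree: by the tower property, remaining rounds can be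
moved from the run into the value function. -/
theorem expect_run_advValue (S : Session.{u} n) (A : S.FailStop) (φ : Assignment n → ℝ≥0∞)
    (k m : ℕ) : (S.run A (k + m)).expect (S.advValue A φ 0) =
      (S.run A k).expect (S.advValue A φ m) := by
  induction m generalizing k with
  | zero => rfl
  | succ m ih =>
    rw [← add_assoc, add_right_comm, ih, run, PMF.expect_bind]
    simp only [PMF.expect_map]
    rfl

theorem next_transcript {S : Session.{u} n} (A : S.FailStop) (c : S.Config) (d : S.Draw) :
    (c.next A d).transcript = S.maskedMsgs (c.next A d).stopped d :: c.transcript := rfl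

/-- Once all corrupted players are silent the adversary has no moves left, so its strategy
disappears from the value. -/
theorem advValue_of_stopped (S : Session.{u} n) (A : S.FailStop) (φ : Assignment n → ℝ≥0∞)
    (m : ℕ) (c : S.Config) (hc : c.stopped = A.corrupted) :
    S.advValue A φ m c = S.value A.corrupted φ m c.state c.transcript := by
  induction m generalizing c with
  | zero => rfl
  | succ m ih =>
    simp only [advValue, value]
    congr 1
    funext d
    have h : (c.next A d).stopped = A.corrupted := by
      simp [Config.next, hc]
    rw [ih _ h, next_transcript, h]
    rfl

theorem advValue_of_never (S : Session.{u} n) (A : S.FailStop) (φ : Assignment n → ℝ≥0∞)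
    (m : ℕ) (c : S.Config) (hc : c.stopped = ∅)
    (hA : ∀ L : List S.Obs, c.view.length < L.length → A.abort L = ∅) :
    S.advValue A φ m c = S.value ∅ φ m c.state c.transcript := by
  induction m generalizing c with
  | zero => rfl
  | succ m ih =>
    simp only [advValue, value]
    congr 1
    funext d
    have h : (c.next A d).stopped = ∅ := by
      simp [Config.next, hc, hA]
    rw [ih _ h, next_transcript, h]
    · rfl
    · intro L hL
      refine hA L (lt_trans ?_ hL)
      simp [Config.next]

/-- If the states of all players outside `C` are the same, then so are the values. -/
theorem value_congr (S : Session.{u} n) (C : Finset (Fin n)) (φ : Assignment n → ℝ≥0∞)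
    (m : ℕ) {s s' : ∀ i, S.State i} (h : ∀ i ∉ C, s i = s' i) (τ : List (RoundMsgs n S.Msg)) :
    S.value C φ m s τ = S.value C φ m s' τ := by
  induction m generalizing s s' τ with
  | zero => rfl
  | succ m ih =>
    simp only [value]
    refine expect_pmfPi_congr _ _ C (fun i hi => by rw [h i hi]) fun d d' hd => ?_
    have : S.maskedMsgs C d = S.maskedMsgs C d' := by
      funext i
      by_cases hi : i ∈ C
      · simp [maskedMsgs, hi]
      · simp [maskedMsgs, hi, hd i hi]
    rw [this]
    exact ih (fun i hi => by rw [hd i hi]) _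

/-! ### Honest histories and the values of stopping along them -/

/-- The states after a history of draws (latest draw first). -/
def histState (S : Session.{u} n) : List S.Draw → ∀ i, S.State i
  | [] => S.init
  | d :: _ => fun i => (d i).1

/-- The transcript of a history in which nobody stopped. -/
def histTranscript (S : Session.{u} n) (h : List S.Draw) : List (RoundMsgs n S.Msg) :=
  h.map (S.maskedMsgs ∅)

/-- The view of an adversary that controls the players in `C`. -/
def histView (S : Session.{u} n) (C : Finset (Fin n)) (h : List S.Draw) : List S.Obs :=
  h.map (S.observe C)

/-- The distribution of what is drawn after a history in which nobody stopped. -/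
noncomputable def histLaw (S : Session.{u} n) (h : List S.Draw) : PMF S.Draw :=
  S.drawLaw (S.histState h) (S.histTranscript h)

/-- The distribution of the history of draws after some rounds in which nobody stopped. -/
noncomputable def history (S : Session.{u} n) : ℕ → PMF (List S.Draw)
  | 0 => PMF.pure []
  | k + 1 => (S.history k).bind fun h => (S.histLaw h).map fun d => d :: h

theorem expect_history_succ (S : Session.{u} n) (k : ℕ) (f : List S.Draw → ℝ≥0∞) :
    (S.history (k + 1)).expect f =
      (S.history k).expect fun h => (S.histLaw h).expect fun d => f (d :: h) := by
  simp only [history, PMF.expect_bind, PMF.expect_map]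

theorem length_of_history (S : Session.{u} n) (k : ℕ) (h : List S.Draw)
    (hh : S.history k h ≠ 0) : h.length = k := by
  induction k generalizing h with
  | zero =>
    have : h ∈ (PMF.pure ([] : List S.Draw)).support := hh
    simp at this
    simp [this]
  | succ k ih =>
    have : h ∈ (S.history (k + 1)).support := hh
    simp only [history, PMF.mem_support_bind_iff, PMF.mem_support_map_iff] at this
    obtain ⟨h', hh', d, -, rfl⟩ := this
    simp [ih h' hh']

/-- The configuration after a history in which nobody stopped. -/
def histConfig (S : Session.{u} n) (C : Finset (Fin n)) (h : List S.Draw) : S.Config :=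
  ⟨S.histState h, ∅, S.histView C h, S.histTranscript h⟩

/-- As long as the adversary does nothing, the execution is honest. -/
theorem run_eq_map_history (S : Session.{u} n) (A : S.FailStop) (k : ℕ)
    (hA : ∀ L : List S.Obs, L.length ≤ k → A.abort L = ∅) :
    S.run A k = (S.history k).map (S.histConfig A.corrupted) := by
  induction k with
  | zero =>
    rw [history, PMF.pure_map]
    rfl
  | succ k ih =>
    rw [run, ih fun L hL => hA L (by omega), history, PMF.bind_map, PMF.map_bind]
    have hlen := S.length_of_history k
    ext c
    simp only [PMF.bind_apply]
    refine tsum_congr fun h => ?_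
    -- Only histories of positive probability are known to have length `k`, which is what makes the
    -- adversary idle in the next round.
    by_cases hh : S.history k h = 0
    · simp [hh]
    congr 1
    rw [PMF.map_comp, Function.comp_apply]
    have : (S.histConfig A.corrupted h).next A =
        S.histConfig A.corrupted ∘ fun d => d :: h := by
      funext d
      have ha : A.abort (S.observe A.corrupted d :: S.histView A.corrupted h) = ∅ :=
        hA _ (by simp [histView, hlen h hh])
      simp only [Config.next, histConfig, ha, Function.comp_apply, histTranscript, List.map_cons,
        maskedMsgs_empty]
      simp [histState, histView]
    rw [← this]
    rfl

/-- The value of the honest continuation of a history. -/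
noncomputable def honestValue (S : Session.{u} n) (φ : Assignment n → ℝ≥0∞) (m : ℕ)
    (h : List S.Draw) : ℝ≥0∞ :=
  S.value ∅ φ m (S.histState h) (S.histTranscript h)

/-- The value of a history if the players in `C` stop after its last round. -/
noncomputable def stopValue (S : Session.{u} n) (C : Finset (Fin n)) (φ : Assignment n → ℝ≥0∞)
    (m : ℕ) (h : List S.Draw) : ℝ≥0∞ :=
  S.value C φ m (S.histState h) (S.histTranscript h)

/-- The value of a history if the players in `C` stop in its last round. -/
noncomputable def lateStopValue (S : Session.{u} n) (C : Finset (Fin n))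
    (φ : Assignment n → ℝ≥0∞) (m : ℕ) : List S.Draw → ℝ≥0∞
  -- A default value: the empty history has no last round, and the expectations below involve
  -- histories of positive length only.
  | [] => S.honestValue φ m []
  | d :: h => S.value C φ m (fun i => (d i).1) (S.maskedMsgs C d :: S.histTranscript h)

theorem stopValue_succ (S : Session.{u} n) (C : Finset (Fin n)) (φ : Assignment n → ℝ≥0∞)
    (m : ℕ) (h : List S.Draw) : S.stopValue C φ (m + 1) h =
      (S.histLaw h).expect fun d => S.lateStopValue C φ m (d :: h) := rfl

theorem honestValue_succ (S : Session.{u} n) (φ : Assignment n → ℝ≥0∞)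
    (m : ℕ) (h : List S.Draw) : S.honestValue φ (m + 1) h =
      (S.histLaw h).expect fun d => S.honestValue φ m (d :: h) := rfl

theorem expect_outcome (S : Session.{u} n) (A : S.FailStop) (φ : Assignment n → ℝ≥0∞)
    (k m : ℕ) (hr : k + m = S.rounds) :
    (S.outcome A).expect φ = (S.run A k).expect (S.advValue A φ m) := by
  rw [outcome, PMF.expect_map, ← expect_run_advValue, hr]
  rfl

theorem expect_honest (S : Session.{u} n) (φ : Assignment n → ℝ≥0∞) (k m : ℕ)
    (hr : k + m = S.rounds) :
    S.honest.expect φ = (S.history k).expect (S.honestValue φ m) := by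
  rw [honest, S.expect_outcome _ φ k m hr, run_eq_map_history _ _ _ fun _ _ => rfl,
    PMF.expect_map]
  congr 1
  funext h
  -- With nobody corrupted, the empty set of stopped players already equals the corrupted set.
  rw [advValue_of_stopped]
  · rfl
  · rfl

open scoped Classical in
/-- The adversary that stops the players in `C` once its view is `v`. -/
noncomputable def stopAt (S : Session.{u} n) (C : Finset (Fin n)) (v : List S.Obs) :
    S.FailStop where
  corrupted := C
  abort L := if L = v then C else ∅

-- The abort in round `k + 1` comes before the messages of that round are sent but after they are
-- seen. Hence a late stop occurs on the fibre of `v`, and an honest continuation everywhere else.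
open scoped Classical in
theorem expect_outcome_stopAt (S : Session.{u} n) (C : Finset (Fin n))
    (φ : Assignment n → ℝ≥0∞) (k m : ℕ) (hr : k + 1 + m = S.rounds) (v : List S.Obs)
    (hv : v.length = k + 1) :
    (S.outcome (S.stopAt C v)).expect φ = (S.history (k + 1)).expect fun h =>
      if S.histView C h = v then S.lateStopValue C φ m h else S.honestValue φ m h := by
  rw [S.expect_outcome _ φ k (m + 1) (by omega), run_eq_map_history, PMF.expect_map,
    expect_history_succ]
  · refine PMF.expect_congr _ fun h hh => ?_
    have hlen := S.length_of_history k h hh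
    change (S.histLaw h).expect _ = _
    congr 1
    funext d
    by_cases hd : S.histView C (d :: h) = v
    · rw [if_pos hd]
      have hd' : S.observe C d :: S.histView C h = v := hd
      rw [advValue_of_stopped]
      · simp only [lateStopValue, Config.next, histConfig, stopAt, hd']
        congr 2
        funext i
        simp [maskedMsgs]
      · simp [Config.next, histConfig, stopAt, hd']
    · rw [if_neg hd]
      have hd' : ¬ S.observe C d :: S.histView C h = v := hd
      rw [advValue_of_never]
      · simp only [honestValue, Config.next, histConfig, stopAt, hd', histState, histTranscript]
        simp [maskedMsgs_empty]
      · simp [Config.next, histConfig, stopAt, hd']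
      · intro L hL
        -- Later views are longer than `k + 1`, so a missed trigger never recurs.
        have : L ≠ v := by
          rintro rfl
          simp [Config.next, histConfig, histView, hlen, hv] at hL
        simp [stopAt, this]
  · intro L hL
    have : L ≠ v := by
      rintro rfl
      omega
    simp [stopAt, this]
/-! ### Exact security forces constant correlation -/

section Unbiased

variable (S : Session.{u} n) (C : Finset (Fin n)) (φ : Assignment n → ℝ≥0∞)

/-- The adversaries that control the players in `C` cannot change the expectation of `φ`. -/
def Unbiasable : Prop :=
  S.honest.expect φ ≠ ∞ ∧
    ∀ A : S.FailStop, A.corrupted = C → (S.outcome A).expect φ = S.honest.expect φ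

variable {S C φ}

/-- Conditionally on any view of `C`, stopping in the current round leaves the mean of `φ`
unchanged: otherwise stopping at exactly that view would shift the overall mean. Weights depending
on the view can then be inserted fibre by fibre. -/
theorem Unbiasable.expect_lateStopValue (hS : S.Unbiasable C φ) {k m : ℕ}
    (hr : k + 1 + m = S.rounds) {f : List S.Draw → ℝ≥0∞}
    (hf : f.FactorsThrough (S.histView C)) :
    ((S.history (k + 1)).expect fun h => f h * S.lateStopValue C φ m h) =
      (S.history (k + 1)).expect fun h => f h * S.honestValue φ m h := by
  classical
  obtain ⟨w, rfl⟩ := (Function.factorsThrough_iff _).1 hf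
  refine PMF.expect_mul_eq_of_fiber _ _ _ _ (fun v => ?_) w
  by_cases hv : v.length = k + 1
  · have h₁ := S.expect_outcome_stopAt C φ k m hr v hv
    rw [hS.2 _ rfl, S.expect_honest φ (k + 1) m hr] at h₁
    have hfin := hS.1
    rw [S.expect_honest φ (k + 1) m hr] at hfin
    -- The contribution off the fibre is common to the honest run and the attacked one; it is
    -- finite, so it cancels in `ℝ≥0∞`.
    let R : List S.Draw → ℝ≥0∞ := {h | S.histView C h = v}ᶜ.indicator (S.honestValue φ m)
    have hR : (S.history (k + 1)).expect R ≠ ∞ :=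
      ne_top_of_le_ne_top hfin (PMF.expect_mono _ fun h => Set.indicator_le_self _ _ h)
    rw [← ENNReal.add_left_inj hR, ← PMF.expect_add, ← PMF.expect_add]
    refine Eq.trans ?_ (h₁.symm.trans ?_)
    · congr 1
      funext h
      by_cases hh : S.histView C h = v <;> simp [R, hh]
    · congr 1
      funext h
      by_cases hh : S.histView C h = v <;> simp [R, hh]
  · refine PMF.expect_congr _ fun h hh => ?_
    have : S.histView C h ≠ v := by
      rintro rfl
      simp [histView, S.length_of_history _ _ hh] at hv
    simp [this]

theorem factorsThrough_histView_tail {f : List S.Draw → ℝ≥0∞}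
    (hf : f.FactorsThrough (S.histView C)) :
    (fun h => f h.tail).FactorsThrough (S.histView C) := by
  intro h h' hh
  refine hf ?_
  simp only [histView] at hh ⊢
  rw [List.map_tail, List.map_tail, hh]

/-- Stopping after round `k` is stopping in round `k + 1` with a decision based only on the first
`k` rounds, hence the weight `f h.tail`. With no round left there is nothing to stop. -/
theorem Unbiasable.expect_stopValue (hS : S.Unbiasable C φ) {k m : ℕ}
    (hr : k + m = S.rounds) {f : List S.Draw → ℝ≥0∞}
    (hf : f.FactorsThrough (S.histView C)) :
    ((S.history k).expect fun h => f h * S.stopValue C φ m h) =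
      (S.history k).expect fun h => f h * S.honestValue φ m h := by
  cases m with
  | zero => rfl
  | succ m =>
    have := hS.expect_lateStopValue (k := k) (m := m) (by omega) (factorsThrough_histView_tail hf)
    simpa only [expect_history_succ, List.tail_cons, PMF.expect_const_mul, ← stopValue_succ,
      ← honestValue_succ] using this

end Unbiased

/-! ### What each side knows, and the invariance of the product expectation -/

theorem histTranscript_eq_of_histView (S : Session.{u} n) (C : Finset (Fin n))
    {h h' : List S.Draw} (hh : S.histView C h = S.histView C h') :
    S.histTranscript h = S.histTranscript h' := by
  have key (h : List S.Draw) :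
      S.histTranscript h = (S.histView C h).map fun o i => some (o i).2 := by
    simp [histTranscript, histView, observe, maskedMsgs_empty, Function.comp_def]
  rw [key, key, hh]

theorem observe_eq {S : Session.{u} n} {C : Finset (Fin n)} {d d' : S.Draw}
    (h : S.observe C d = S.observe C d') : ∀ i ∈ C, d i = d' i := by
  intro i hi
  have := congrFun h i
  simp only [observe, hi, if_true, Prod.mk.injEq, Option.some.injEq] at this
  exact Prod.ext this.1 this.2

theorem histState_eq_of_histView (S : Session.{u} n) (C : Finset (Fin n))
    {h h' : List S.Draw} (hh : S.histView C h = S.histView C h') :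
    ∀ i ∈ C, S.histState h i = S.histState h' i := by
  intro i hi
  match h, h', hh with
  | [], [], _ => rfl
  | [], _ :: _, hh => simp [histView] at hh
  | _ :: _, [], hh => simp [histView] at hh
  | d :: h, d' :: h', hh =>
    simp only [histView, List.map_cons, List.cons.injEq] at hh
    simp only [histState, observe_eq hh.1 i hi]

theorem maskedMsgs_congr (S : Session.{u} n) (C : Finset (Fin n)) {d d' : S.Draw}
    (h : ∀ i ∉ C, d i = d' i) : S.maskedMsgs C d = S.maskedMsgs C d' := by
  funext i
  by_cases hi : i ∈ C
  · simp [maskedMsgs, hi]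
  · simp [maskedMsgs, hi, h i hi]

/-- The value after the players outside `C` stopped is known to those in `C`. -/
theorem stopValue_factorsThrough (S : Session.{u} n) (C : Finset (Fin n))
    (φ : Assignment n → ℝ≥0∞) (m : ℕ) :
    (S.stopValue Cᶜ φ m).FactorsThrough (S.histView C) := by
  intro h h' hh
  rw [stopValue, stopValue, S.histTranscript_eq_of_histView C hh]
  refine S.value_congr _ _ _ (fun i hi => ?_) _
  exact S.histState_eq_of_histView C hh i (by simpa using hi)

theorem lateStopValue_factorsThrough (S : Session.{u} n) (C : Finset (Fin n))
    (φ : Assignment n → ℝ≥0∞) (m : ℕ) :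
    (S.lateStopValue Cᶜ φ m).FactorsThrough (S.histView C) := by
  intro h h' hh
  match h, h', hh with
  | [], [], _ => rfl
  | [], _ :: _, hh => simp [histView] at hh
  | _ :: _, [], hh => simp [histView] at hh
  | d :: h, d' :: h', hh =>
    simp only [histView, List.map_cons, List.cons.injEq] at hh
    have hd : ∀ i ∉ Cᶜ, d i = d' i := fun i hi => observe_eq hh.1 i (by simpa using hi)
    rw [lateStopValue, lateStopValue, S.histTranscript_eq_of_histView C hh.2,
      S.maskedMsgs_congr _ hd]
    exact S.value_congr _ _ _ (fun i hi => by rw [hd i hi]) _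

/-- Given the history, what happens if one side stops in the next round is independent of what
happens if the other side does. -/
theorem expect_lateStopValue_mul (S : Session.{u} n) (C : Finset (Fin n))
    (φ ψ : Assignment n → ℝ≥0∞) (k m : ℕ) :
    ((S.history (k + 1)).expect fun h => S.lateStopValue Cᶜ φ m h * S.lateStopValue C ψ m h) =
      (S.history k).expect fun h => S.stopValue Cᶜ φ (m + 1) h * S.stopValue C ψ (m + 1) h := by
  rw [expect_history_succ]
  congr 1
  funext h
  rw [stopValue_succ, stopValue_succ]
  refine expect_pmfPi_mul_of_indep _ C (fun d d' hd => ?_) fun d d' hd => ?_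
  · have hd : ∀ i ∉ Cᶜ, d i = d' i := fun i hi => hd i (by simpa using hi)
    rw [lateStopValue, lateStopValue, S.maskedMsgs_congr _ hd]
    exact S.value_congr _ _ _ (fun i hi => by rw [hd i hi]) _
  · rw [lateStopValue, lateStopValue, S.maskedMsgs_congr _ hd]
    exact S.value_congr _ _ _ (fun i hi => by rw [hd i hi]) _

/-- If each side cannot bias the result of the other one, then the expectation of the
product of the two results after one side or the other stopped is the same at all times. -/
theorem expect_stopValue_mul_succ (S : Session.{u} n) (C : Finset (Fin n))
    {φ ψ : Assignment n → ℝ≥0∞}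
    (hφ : S.Unbiasable Cᶜ φ) (hψ : S.Unbiasable C ψ) {k m : ℕ} (hr : k + 1 + m = S.rounds) :
    ((S.history (k + 1)).expect fun h => S.stopValue Cᶜ φ m h * S.stopValue C ψ m h) =
      (S.history k).expect fun h => S.stopValue Cᶜ φ (m + 1) h * S.stopValue C ψ (m + 1) h := by
  -- `Cᶜᶜ = C`: the value of `ψ` after `C` stops is computable by `Cᶜ`, so `Cᶜ` may use it as a
  -- weight.
  have f₁ : (S.stopValue C ψ m).FactorsThrough (S.histView Cᶜ) := by
    simpa using S.stopValue_factorsThrough Cᶜ ψ m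
  have f₂ := S.lateStopValue_factorsThrough C φ m
  calc
    _ = (S.history (k + 1)).expect fun h => S.stopValue C ψ m h * S.stopValue Cᶜ φ m h := by
      simp only [mul_comm]
    _ = (S.history (k + 1)).expect fun h => S.stopValue C ψ m h * S.lateStopValue Cᶜ φ m h := by
      rw [hφ.expect_stopValue hr f₁, hφ.expect_lateStopValue hr f₁]
    _ = (S.history (k + 1)).expect fun h => S.lateStopValue Cᶜ φ m h * S.stopValue C ψ m h := by
      simp only [mul_comm]
    _ = (S.history (k + 1)).expect fun h =>
          S.lateStopValue Cᶜ φ m h * S.lateStopValue C ψ m h := by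
      rw [hψ.expect_stopValue hr f₂, hψ.expect_lateStopValue hr f₂]
    _ = _ := S.expect_lateStopValue_mul C φ ψ k m

theorem expect_stopValue_mul (S : Session.{u} n) (C : Finset (Fin n))
    {φ ψ : Assignment n → ℝ≥0∞}
    (hφ : S.Unbiasable Cᶜ φ) (hψ : S.Unbiasable C ψ) {k m : ℕ} (hr : k + m = S.rounds) :
    ((S.history k).expect fun h => S.stopValue Cᶜ φ m h * S.stopValue C ψ m h) =
      S.honest.expect φ * S.honest.expect ψ := by
  induction k generalizing m with
  | zero =>
    -- With constant weight and the deterministic empty history, stopping at the outset gives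
    -- exactly the honest mean.
    have h₁ := hφ.expect_stopValue hr (f := fun _ => 1) fun _ _ _ => rfl
    have h₂ := hψ.expect_stopValue hr (f := fun _ => 1) fun _ _ _ => rfl
    rw [S.expect_honest φ 0 m hr, S.expect_honest ψ 0 m hr]
    simp only [history, PMF.expect_pure, one_mul] at h₁ h₂ ⊢
    rw [h₁, h₂]
  | succ k ih =>
    rw [S.expect_stopValue_mul_succ C hφ hψ hr]
    exact ih (by omega)

/-- If complementary sets of players cannot bias the expectations of `φ` and of `ψ`,
respectively, then `φ` and `ψ` are uncorrelated in the honest execution. -/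
theorem expect_mul_of_unbiasable (S : Session.{u} n) (C : Finset (Fin n))
    {φ ψ : Assignment n → ℝ≥0∞} (hφ : S.Unbiasable Cᶜ φ) (hψ : S.Unbiasable C ψ) :
    (S.honest.expect fun a => φ a * ψ a) = S.honest.expect φ * S.honest.expect ψ := by
  rw [← S.expect_stopValue_mul C hφ hψ (k := S.rounds) (m := 0) rfl,
    S.expect_honest _ S.rounds 0 rfl]
  rfl

end Session

/-! ### Ordinal efficiency excludes profitable exchanges -/

theorem sum_Iic_perm_ite {n : ℕ} (o : Equiv.Perm (Fin n)) (j l : Fin n) :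
    ∑ k ∈ Finset.Iic l, (if o k = j then (1 : ℝ) else 0) = if o.symm j ≤ l then 1 else 0 := by
  simp only [← Equiv.eq_symm_apply]
  simp

/-- In an ordinally efficient matrix no two players can exchange shares of two items so that both
of them gain. -/
theorem OrdEfficient.no_exchange {n : ℕ} {σ : Profile n} {P : Matrix (Fin n) (Fin n) ℝ}
    (hP : OrdEfficient σ P) {i i' j j' : Fin n} (hi : (σ i).symm j < (σ i).symm j')
    (hi' : (σ i').symm j' < (σ i').symm j) (h₁ : 0 < P i j') : P i' j = 0 := by
  by_contra hne
  obtain ⟨hds, hmax⟩ := hP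
  have hds' := mem_doublyStochastic_iff_sum.1 hds
  have h₂ : 0 < P i' j := lt_of_le_of_ne (hds'.1 i' j) (Ne.symm hne)
  have hii' : i ≠ i' := by
    rintro rfl
    exact lt_asymm hi hi'
  have hjj' : j ≠ j' := by
    rintro rfl
    exact lt_irrefl _ hi
  -- The exchange adds `ε` times the rank-one matrix `u vᵀ`, whose row and column sums vanish. Only
  -- the entries `(i, j')` and `(i', j)` decrease, so this `ε` keeps the matrix nonnegative.
  set ε := min (P i j') (P i' j) with hε
  have hε0 : 0 < ε := lt_min h₁ h₂
  let u : Fin n → ℝ := fun r => (if r = i then 1 else 0) - if r = i' then 1 else 0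
  let v : Fin n → ℝ := fun s => (if s = j then 1 else 0) - if s = j' then 1 else 0
  let Q : Matrix (Fin n) (Fin n) ℝ := fun r s => P r s + ε * u r * v s
  have hu : ∑ r, u r = 0 := by simp [u]
  have hv : ∑ s, v s = 0 := by simp [v]
  refine hmax ⟨Q, mem_doublyStochastic_iff_sum.2 ⟨fun r s => ?_, fun r => ?_, fun s => ?_⟩, ?_,
    fun r l => ?_⟩
  · have h0 := hds'.1 r s
    have e₁ : ε ≤ P i j' := min_le_left _ _
    have e₂ : ε ≤ P i' j := min_le_right _ _
    simp only [Q, u, v]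
    by_cases hr : r = i
    · subst hr
      by_cases hs : s = j'
      · subst hs
        simp [hii', hjj'.symm]
        linarith
      · by_cases hs' : s = j
        · subst hs'
          simp only [hii', hs, if_true, if_false]
          linarith
        · simpa [hii', hs, hs'] using h0
    · by_cases hr' : r = i'
      · subst hr'
        by_cases hs : s = j
        · subst hs
          simp [hr, hjj']
          linarith
        · by_cases hs' : s = j'
          · subst hs'
            simp only [hr, hs, if_true, if_false]
            linarith
          · simpa [hr, hs, hs'] using h0
      · simpa [hr, hr'] using h0
  · simp only [Q, Finset.sum_add_distrib, ← Finset.mul_sum, hv, hds'.2.1 r]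
    simp
  · simp only [Q, Finset.sum_add_distrib, ← Finset.mul_sum, ← Finset.sum_mul, hu, hds'.2.2 s]
    simp
  · intro h
    have := congrFun (congrFun h i) j
    simp [Q, u, v, hii', hjj'] at this
    exact hε0.ne' this
  · simp only [Q, Finset.sum_add_distrib, ← Finset.mul_sum, v, Finset.sum_sub_distrib,
      sum_Iic_perm_ite, le_add_iff_nonneg_right]
    rw [mul_assoc]
    refine mul_nonneg hε0.le ?_
    simp only [u]
    by_cases hr : r = i
    · subst hr
      simp only [hii', if_true, if_false]
      split_ifs with a b b
      all_goals first | exact absurd (hi.le.trans b) a | norm_num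
    · by_cases hr' : r = i'
      · subst hr'
        simp only [hr, if_true, if_false]
        split_ifs with a b b
        all_goals first | exact absurd (hi'.le.trans a) b | norm_num
      · simp [hr, hr']

/-! ### The conflict profile -/

/-- A profile in which players `0` and `1` compete for item `0` and players `2` and `3` for
item `3`. The second choice is item `1` for players `0` and `2`, and item `2` for players `1`
and `3`. Every further player has a favourite item of its own. -/
def conflictProfile (m : ℕ) : Profile (m + 4) := fun i =>
  if i = 0 then 1
  else if i = 1 then Equiv.swap 1 2
  else if i = 2 then Equiv.swap 0 3
  else if i = 3 then Equiv.swap 0 3 * Equiv.swap 1 2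
  else (Fin.cycleRange i).symm

section ConflictProfile

variable {m : ℕ}

@[simp]
theorem two_mod_add_four : 2 % (m + 4) = 2 := Nat.mod_eq_of_lt (by omega)

@[simp]
theorem three_mod_add_four : 3 % (m + 4) = 3 := Nat.mod_eq_of_lt (by omega)

theorem val_literals_add_four : ((0 : Fin (m + 4)) : ℕ) = 0 ∧ ((1 : Fin (m + 4)) : ℕ) = 1 ∧
    ((2 : Fin (m + 4)) : ℕ) = 2 ∧ ((3 : Fin (m + 4)) : ℕ) = 3 := by
  refine ⟨rfl, ?_, ?_, ?_⟩ <;> rw [Fin.coe_ofNat_eq_mod] <;> exact Nat.mod_eq_of_lt (by omega)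

theorem conflictProfile_zero : conflictProfile m 0 = 1 := rfl

theorem conflictProfile_one : conflictProfile m 1 = Equiv.swap 1 2 := by
  simp [conflictProfile]

theorem conflictProfile_two : conflictProfile m 2 = Equiv.swap 0 3 := by
  simp [conflictProfile, Fin.ext_iff]

theorem conflictProfile_three : conflictProfile m 3 = Equiv.swap 0 3 * Equiv.swap 1 2 := by
  simp [conflictProfile, Fin.ext_iff]

theorem conflictProfile_zero_symm (j : Fin (m + 4)) : (conflictProfile m 0).symm j = j := rfl

theorem conflictProfile_one_symm (j : Fin (m + 4)) :
    (conflictProfile m 1).symm j = Equiv.swap 1 2 j := by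
  rw [conflictProfile_one, Equiv.symm_swap]

theorem conflictProfile_two_symm (j : Fin (m + 4)) :
    (conflictProfile m 2).symm j = Equiv.swap 0 3 j := by
  rw [conflictProfile_two, Equiv.symm_swap]

theorem conflictProfile_three_symm (j : Fin (m + 4)) :
    (conflictProfile m 3).symm j = Equiv.swap 1 2 (Equiv.swap 0 3 j) := by
  rw [conflictProfile_three, ← Equiv.Perm.inv_def, mul_inv_rev, Equiv.swap_inv, Equiv.swap_inv,
    Equiv.Perm.mul_apply]

theorem conflictProfile_of_four_le {i : Fin (m + 4)} (hi : 4 ≤ (i : ℕ)) :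
    conflictProfile m i = (Fin.cycleRange i).symm := by
  have h : i ≠ 0 ∧ i ≠ 1 ∧ i ≠ 2 ∧ i ≠ 3 := by
    refine ⟨?_, ?_, ?_, ?_⟩ <;> rintro rfl <;> simp at hi
  simp [conflictProfile, h.1, h.2.1, h.2.2.1, h.2.2.2]

theorem Fin.eq_or_four_le (i : Fin (m + 4)) : i = 0 ∨ i = 1 ∨ i = 2 ∨ i = 3 ∨ 4 ≤ (i : ℕ) := by
  obtain ⟨h₀, h₁, h₂, h₃⟩ := val_literals_add_four (m := m)
  simp only [Fin.ext_iff, h₀, h₁, h₂, h₃]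
  omega

/-- Every player below `k` ranks item `k` after all smaller items, which makes the descending
induction of `OrdEfficient.conflict_diag` work. -/
theorem conflictProfile_symm_lt {i j k : Fin (m + 4)} (hk : 4 ≤ (k : ℕ)) (hi : i < k)
    (hj : j < k) : (conflictProfile m i).symm j < (conflictProfile m i).symm k := by
  obtain ⟨h₀, h₁, h₂, h₃⟩ := val_literals_add_four (m := m)
  rw [Fin.lt_def] at hi hj ⊢
  rcases Fin.eq_or_four_le i with rfl | rfl | rfl | rfl | h
  · exact hj
  · simp only [conflictProfile_one_symm, Equiv.swap_apply_def, Fin.ext_iff]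
    split_ifs <;> omega
  · simp only [conflictProfile_two_symm, Equiv.swap_apply_def, Fin.ext_iff]
    split_ifs <;> omega
  · simp only [conflictProfile_three_symm, Equiv.swap_apply_def, Fin.ext_iff]
    split_ifs <;> omega
  · rw [conflictProfile_of_four_le h, Equiv.symm_symm, Fin.cycleRange_of_gt hi]
    rcases lt_trichotomy j i with h' | rfl | h'
    · rw [Fin.coe_cycleRange_of_lt h']
      have := Fin.lt_def.1 h'
      omega
    · rw [Fin.cycleRange_self]
      omega
    · rwa [Fin.cycleRange_of_gt h']

theorem conflictProfile_symm_self_lt {j k : Fin (m + 4)} (hk : 4 ≤ (k : ℕ)) (hj : j ≠ k) :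
    (conflictProfile m k).symm k < (conflictProfile m k).symm j := by
  rw [conflictProfile_of_four_le hk, Equiv.symm_symm, Fin.cycleRange_self]
  refine Fin.pos_of_ne_zero fun h => hj ?_
  rw [← Fin.cycleRange_self k] at h
  exact (Fin.cycleRange k).injective h

end ConflictProfile

/-- Each of the first four players receives each of its two favourite items of the conflict profile
with probability `1/2`. -/
structure IsConflictMatrix {m : ℕ} (P : Matrix (Fin (m + 4)) (Fin (m + 4)) ℝ) : Prop where
  zero_zero : P 0 0 = 1 / 2
  zero_one : P 0 1 = 1 / 2
  one_zero : P 1 0 = 1 / 2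
  one_two : P 1 2 = 1 / 2
  two_three : P 2 3 = 1 / 2
  two_one : P 2 1 = 1 / 2
  three_three : P 3 3 = 1 / 2
  three_two : P 3 2 = 1 / 2

/-! ### Ordinal efficiency and strong equal treatment on the conflict profile -/

section ConflictMatrix

variable {m : ℕ} {P : Matrix (Fin (m + 4)) (Fin (m + 4)) ℝ}

theorem Fin.sum_univ_add_four {M : Type*} [AddCommMonoid M] (f : Fin (m + 4) → M)
    (hf : ∀ i : Fin (m + 4), 4 ≤ (i : ℕ) → f i = 0) : ∑ i, f i = f 0 + f 1 + f 2 + f 3 := by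
  obtain ⟨h₀, h₁, h₂, h₃⟩ := val_literals_add_four (m := m)
  rw [← Finset.sum_subset (Finset.subset_univ {0, 1, 2, 3})]
  · rw [Finset.sum_insert, Finset.sum_insert, Finset.sum_insert, Finset.sum_singleton]
    · abel
    all_goals simp [Fin.ext_iff]
  · intro i _ hi
    refine hf i ?_
    simp only [Finset.mem_insert, Finset.mem_singleton, not_or] at hi
    rcases Fin.eq_or_four_le i with h | h | h | h | h <;> tauto

theorem entry_eq_zero_of_row (hP : P ∈ doublyStochastic ℝ (Fin (m + 4))) {i j k : Fin (m + 4)}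
    (hjk : j ≠ k) (h : P i k = 1) : P i j = 0 := by
  have hds := mem_doublyStochastic_iff_sum.1 hP
  have := Finset.add_le_sum (s := Finset.univ) (f := fun j => P i j) (fun j _ => hds.1 i j)
    (Finset.mem_univ k) (Finset.mem_univ j) hjk.symm
  have := hds.2.1 i
  have := hds.1 i j
  linarith

theorem entry_eq_zero_of_col (hP : P ∈ doublyStochastic ℝ (Fin (m + 4))) {i j k : Fin (m + 4)}
    (hjk : j ≠ k) (h : P k i = 1) : P j i = 0 :=
  entry_eq_zero_of_row (P := P.transpose) (transpose_mem_doublyStochastic_iff.2 hP) hjk h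

theorem exists_pos_of_row_lt_one (hP : P ∈ doublyStochastic ℝ (Fin (m + 4))) {i k : Fin (m + 4)}
    (h : P i k ≠ 1) : ∃ j ≠ k, 0 < P i j := by
  have hds := mem_doublyStochastic_iff_sum.1 hP
  by_contra! hcon
  refine h ?_
  rw [← hds.2.1 i, Finset.sum_eq_single k]
  · exact fun j _ hj => le_antisymm (hcon j hj) (hds.1 i j)
  · simp

theorem exists_pos_of_col_lt_one (hP : P ∈ doublyStochastic ℝ (Fin (m + 4))) {i k : Fin (m + 4)}
    (h : P k i ≠ 1) : ∃ j ≠ k, 0 < P j i :=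
  exists_pos_of_row_lt_one (P := P.transpose) (transpose_mem_doublyStochastic_iff.2 hP) h

/-- Descending induction on `k`. If `k` holds a share of some `j ≠ k`, then some `i ≠ k` holds a
share of `k`; the larger indices are already matched, so `i, j < k`. Then `i` prefers `j` and `k`
prefers `k`, and they would trade. -/
theorem OrdEfficient.conflict_diag (hP : OrdEfficient (conflictProfile m) P) (k : Fin (m + 4))
    (hk : 4 ≤ (k : ℕ)) : P k k = 1 := by
  induction k using WellFoundedGT.induction with
  | ind k ih =>
    by_contra hne
    obtain ⟨j, hjk, hj⟩ := exists_pos_of_row_lt_one hP.1 hne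
    obtain ⟨i, hik, hi⟩ := exists_pos_of_col_lt_one hP.1 hne
    have hj' : j < k := by
      refine lt_of_le_of_ne (not_lt.1 fun h => ?_) hjk
      have := ih j h (hk.trans (Fin.lt_def.1 h).le)
      exact hj.ne' (entry_eq_zero_of_col hP.1 h.ne this)
    have hi' : i < k := by
      refine lt_of_le_of_ne (not_lt.1 fun h => ?_) hik
      have := ih i h (hk.trans (Fin.lt_def.1 h).le)
      exact hi.ne' (entry_eq_zero_of_row hP.1 h.ne this)
    exact hi.ne' (hP.no_exchange (conflictProfile_symm_self_lt hk hjk)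
      (conflictProfile_symm_lt hk hi' hj') hj)

/-- Here `x` is the favourite of `i` and the worst of the first four items for `i'`. Either `i`
takes all of `x`, or `i` holds something that it would trade for any share of `x` held by `i'`. -/
theorem OrdEfficient.conflict_bottom (hP : OrdEfficient (conflictProfile m) P)
    {i i' x : Fin (m + 4)} (hii' : i' ≠ i)
    (h : ∀ j ≠ x, (conflictProfile m i).symm x < (conflictProfile m i).symm j)
    (h' : ∀ j ≠ x, (j : ℕ) < 4 → (conflictProfile m i').symm j < (conflictProfile m i').symm x)
    (hi : (i : ℕ) < 4) : P i' x = 0 := by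
  by_cases h1 : P i x = 1
  · exact entry_eq_zero_of_col hP.1 hii' h1
  · obtain ⟨j, hjx, hj⟩ := exists_pos_of_row_lt_one hP.1 h1
    refine hP.no_exchange (h j hjx) (h' j hjx ?_) hj
    by_contra hj4
    refine hj.ne' (entry_eq_zero_of_col hP.1 ?_ (hP.conflict_diag j (by omega)))
    rintro rfl
    omega

theorem OrdEfficient.isConflictMatrix (hP : OrdEfficient (conflictProfile m) P)
    (hS : StrongEqualTreat (conflictProfile m) P) : IsConflictMatrix P := by
  obtain ⟨h₀, h₁, h₂, h₃⟩ := val_literals_add_four (m := m)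
  have hds := mem_doublyStochastic_iff_sum.1 hP.1
  have r₀ := conflictProfile_zero_symm (m := m)
  have r₁ := conflictProfile_one_symm (m := m)
  have r₂ := conflictProfile_two_symm (m := m)
  have r₃ := conflictProfile_three_symm (m := m)
  have row (i : Fin (m + 4)) (hi : (i : ℕ) < 4) : P i 0 + P i 1 + P i 2 + P i 3 = 1 := by
    rw [← hds.2.1 i, Fin.sum_univ_add_four]
    intro k hk
    refine entry_eq_zero_of_col hP.1 ?_ (hP.conflict_diag k hk)
    rintro rfl
    omega
  have col (j : Fin (m + 4)) (hj : (j : ℕ) < 4) : P 0 j + P 1 j + P 2 j + P 3 j = 1 := by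
    rw [← hds.2.2 j, Fin.sum_univ_add_four]
    intro k hk
    refine entry_eq_zero_of_row hP.1 ?_ (hP.conflict_diag k hk)
    rintro rfl
    omega
  have z20 : P 2 0 = 0 := by
    refine hP.conflict_bottom (i := 0) (by simp [Fin.ext_iff]) (fun j hj => ?_)
      (fun j hj hj4 => ?_) (by omega)
    all_goals
      simp only [r₀, r₂, Equiv.swap_apply_def, Fin.ext_iff, Fin.lt_def, ne_eq] at hj ⊢
      (try split_ifs) <;> omega
  have z30 : P 3 0 = 0 := by
    refine hP.conflict_bottom (i := 0) (by simp [Fin.ext_iff]) (fun j hj => ?_)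
      (fun j hj hj4 => ?_) (by omega)
    all_goals
      simp only [r₀, r₃, Equiv.swap_apply_def, Fin.ext_iff, Fin.lt_def, ne_eq] at hj ⊢
      (try split_ifs) <;> omega
  have z03 : P 0 3 = 0 := by
    refine hP.conflict_bottom (i := 2) (by simp [Fin.ext_iff]) (fun j hj => ?_)
      (fun j hj hj4 => ?_) (by omega)
    all_goals
      simp only [r₀, r₂, Equiv.swap_apply_def, Fin.ext_iff, Fin.lt_def, ne_eq] at hj ⊢
      (try split_ifs) <;> omega
  have z13 : P 1 3 = 0 := by
    refine hP.conflict_bottom (i := 2) (by simp [Fin.ext_iff]) (fun j hj => ?_)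
      (fun j hj hj4 => ?_) (by omega)
    all_goals
      simp only [r₁, r₂, Equiv.swap_apply_def, Fin.ext_iff, Fin.lt_def, ne_eq] at hj ⊢
      (try split_ifs) <;> omega
  have e₁ : P 0 0 = P 1 0 := by
    -- Only agreement on the favourite item is used; with column `0` it yields the shares `1/2`.
    have := hS 0 1 0 (fun k hk => ?_) 0 le_rfl
    · simpa [conflictProfile_zero, conflictProfile_one, Equiv.swap_apply_def, Fin.ext_iff]
        using this
    · obtain rfl : k = 0 := le_antisymm hk (Fin.zero_le k)
      simp [conflictProfile_zero, conflictProfile_one, Equiv.swap_apply_def, Fin.ext_iff]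
  have e₂ : P 2 3 = P 3 3 := by
    have := hS 2 3 0 (fun k hk => ?_) 0 le_rfl
    · simpa [conflictProfile_two, conflictProfile_three, Equiv.swap_apply_def, Fin.ext_iff]
        using this
    · obtain rfl : k = 0 := le_antisymm hk (Fin.zero_le k)
      simp [conflictProfile_two, conflictProfile_three, Equiv.swap_apply_def, Fin.ext_iff]
  have b_lt {i : Fin (m + 4)} (hi : i = 0 ∨ i = 2) :
      (conflictProfile m i).symm 1 < (conflictProfile m i).symm 2 := by
    rcases hi with rfl | rfl <;>
      simp only [r₀, r₂, Equiv.swap_apply_def, Fin.ext_iff, Fin.lt_def] <;>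
      (try split_ifs) <;> omega
  have c_lt {i : Fin (m + 4)} (hi : i = 1 ∨ i = 3) :
      (conflictProfile m i).symm 2 < (conflictProfile m i).symm 1 := by
    rcases hi with rfl | rfl <;>
      simp only [r₁, r₃, Equiv.swap_apply_def, Fin.ext_iff, Fin.lt_def] <;>
      (try split_ifs) <;> omega
  have row0 := row 0 (by omega)
  have row1 := row 1 (by omega)
  have row2 := row 2 (by omega)
  have row3 := row 3 (by omega)
  have col0 := col 0 (by omega)
  have col1 := col 1 (by omega)
  have col2 := col 2 (by omega)
  have col3 := col 3 (by omega)
  have nn := hds.1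
  have z02 : P 0 2 = 0 := by
    -- A share of item `2` held by player `0` would exclude players `1` and `3` from item `1`. Each
    -- would then need half of item `2`, leaving none of it for player `0`.
    by_contra h
    have h := lt_of_le_of_ne (nn 0 2) (Ne.symm h)
    have y₁ := hP.no_exchange (b_lt (.inl rfl)) (c_lt (.inl rfl)) h
    have y₂ := hP.no_exchange (b_lt (.inl rfl)) (c_lt (.inr rfl)) h
    linarith [nn 2 2]
  have z22 : P 2 2 = 0 := by
    by_contra h
    have h := lt_of_le_of_ne (nn 2 2) (Ne.symm h)
    have y₁ := hP.no_exchange (b_lt (.inr rfl)) (c_lt (.inl rfl)) h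
    have y₂ := hP.no_exchange (b_lt (.inr rfl)) (c_lt (.inr rfl)) h
    linarith [nn 0 2]
  -- Players `0` and `2` now fill column `1` with two halves.
  have z11 : P 1 1 = 0 := by linarith [nn 1 1, nn 3 1]
  have z31 : P 3 1 = 0 := by linarith [nn 1 1, nn 3 1]
  constructor <;> linarith

end ConflictMatrix

/-! ### The probabilistic serial matrix of the conflict profile -/

section Phase

variable {n : ℕ} {σ : Profile n} {P : Matrix (Fin n) (Fin n) ℚ} {f : Fin n → Fin n}

theorem psEats_iff (hleft : ∀ i, 0 < psLeft P (f i))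
    (hfav : ∀ i j, 0 < psLeft P j → (σ i).symm (f i) ≤ (σ i).symm j) (i j : Fin n) :
    PsEats σ P i j ↔ f i = j := by
  constructor
  · rintro ⟨hj, h⟩
    exact (σ i).symm.injective (le_antisymm (hfav i j hj) (h _ (hleft i)))
  · rintro rfl
    exact ⟨hleft i, hfav i⟩

/-- One phase of simultaneous eating in which player `i` consumes item `f i` for time `c`. -/
theorem psStep_eq (hleft : ∀ i, 0 < psLeft P (f i))
    (hfav : ∀ i j, 0 < psLeft P j → (σ i).symm (f i) ≤ (σ i).symm j) {c : ℚ}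
    (hc : ∀ i, c * (Finset.univ.filter fun i' => f i' = f i).card ≤ psLeft P (f i))
    {i₀ : Fin n} (h₀ : psLeft P (f i₀) = c * (Finset.univ.filter fun i' => f i' = f i₀).card) :
    psStep σ P = fun i j => P i j + if f i = j then c else 0 := by
  have heats := psEats_iff hleft hfav
  have heaters (j : Fin n) : psEaters σ P j = Finset.univ.filter fun i => f i = j := by
    simp [psEaters, heats]
  have hpos (i : Fin n) : (0 : ℚ) < (Finset.univ.filter fun i' => f i' = f i).card := by
    exact_mod_cast Finset.card_pos.2 ⟨i, by simp⟩
  have hact (i : Fin n) : f i ∈ psActive σ P := by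
    simp only [psActive, heaters, Finset.mem_filter, Finset.mem_univ, true_and]
    exact ⟨i, by simp⟩
  -- Item `f i₀` is used up exactly at time `c` by `h₀`, and no active item earlier by `hc`.
  have htime : psTime σ P = c := by
    have hne : (psActive σ P).Nonempty := ⟨_, hact i₀⟩
    rw [psTime, dif_pos hne]
    refine le_antisymm ?_ (Finset.le_inf' _ _ fun j hj => ?_)
    · refine (Finset.inf'_le _ (hact i₀)).trans ?_
      rw [heaters, h₀, mul_div_cancel_right₀ _ (hpos i₀).ne']
    · simp only [psActive, heaters, Finset.mem_filter, Finset.mem_univ, true_and] at hj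
      obtain ⟨i, hi⟩ := hj
      obtain rfl : f i = j := by simpa using hi
      rw [heaters, le_div_iff₀ (hpos i)]
      exact hc i
  funext i j
  simp [psStep, heats, htime]

theorem psLeft_add (c : ℚ) (j : Fin n) :
    psLeft (fun i j => P i j + if f i = j then c else 0) j =
      psLeft P j - c * (Finset.univ.filter fun i => f i = j).card := by
  simp only [psLeft, Finset.sum_add_distrib, ← Finset.sum_filter, Finset.sum_const, nsmul_eq_mul]
  ring

theorem psStep_eq_self (h : ∀ j, psLeft P j = 0) : psStep σ P = P := by
  funext i j
  simp [psStep, PsEats, h]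

end Phase

section ConflictSerial

variable {m : ℕ}

theorem card_fiber_add_four {f : Fin (m + 4) → Fin (m + 4)}
    (hf : ∀ i : Fin (m + 4), 4 ≤ (i : ℕ) → f i = i) {j : Fin (m + 4)} (hj : (j : ℕ) < 4) :
    (Finset.univ.filter fun i => f i = j).card = (if f 0 = j then 1 else 0) +
      (if f 1 = j then 1 else 0) + (if f 2 = j then 1 else 0) + if f 3 = j then 1 else 0 := by
  rw [Finset.card_filter, Fin.sum_univ_add_four]
  intro i hi
  rw [hf i hi, if_neg]
  rintro rfl
  omega

theorem card_fiber_of_four_le {f : Fin (m + 4) → Fin (m + 4)}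
    (hf : ∀ i : Fin (m + 4), 4 ≤ (i : ℕ) → f i = i)
    (hf' : ∀ i : Fin (m + 4), (i : ℕ) < 4 → (f i : ℕ) < 4) {j : Fin (m + 4)}
    (hj : 4 ≤ (j : ℕ)) : (Finset.univ.filter fun i => f i = j).card = 1 := by
  rw [Finset.card_eq_one]
  refine ⟨j, ?_⟩
  ext i
  simp only [Finset.mem_filter, Finset.mem_univ, true_and, Finset.mem_singleton]
  constructor
  · rintro rfl
    by_cases hi : 4 ≤ (i : ℕ)
    · exact (hf i hi).symm
    · have := hf' i (by omega)
      omega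
  · rintro rfl
    exact hf i hj

/-- The items consumed in the first phase. -/
def conflictFirst (m : ℕ) (i : Fin (m + 4)) : Fin (m + 4) :=
  if 4 ≤ (i : ℕ) then i else if i = 0 ∨ i = 1 then 0 else 3

/-- The items consumed in the second phase. -/
def conflictSecond (m : ℕ) (i : Fin (m + 4)) : Fin (m + 4) :=
  if 4 ≤ (i : ℕ) then i else if i = 0 ∨ i = 2 then 1 else 2

theorem card_conflictFirst (j : Fin (m + 4)) :
    (Finset.univ.filter fun i => conflictFirst m i = j).card =
      if 4 ≤ (j : ℕ) then 1 else if j = 0 ∨ j = 3 then 2 else 0 := by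
  obtain ⟨h₀, h₁, h₂, h₃⟩ := val_literals_add_four (m := m)
  split_ifs with hj hj'
  · refine card_fiber_of_four_le (f := conflictFirst m) (fun i hi => if_pos hi) (fun i hi => ?_) hj
    simp only [conflictFirst]
    split_ifs <;> omega
  · rw [card_fiber_add_four (f := conflictFirst m) (fun i hi => if_pos hi) (by omega)]
    rcases hj' with rfl | rfl <;> simp [conflictFirst, Fin.ext_iff]
  · rw [card_fiber_add_four (f := conflictFirst m) (fun i hi => if_pos hi) (by omega)]
    rcases Fin.eq_or_four_le j with rfl | rfl | rfl | rfl | h <;> tauto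

theorem card_conflictSecond (j : Fin (m + 4)) :
    (Finset.univ.filter fun i => conflictSecond m i = j).card =
      if 4 ≤ (j : ℕ) then 1 else if j = 0 ∨ j = 3 then 0 else 2 := by
  obtain ⟨h₀, h₁, h₂, h₃⟩ := val_literals_add_four (m := m)
  split_ifs with hj hj'
  · refine card_fiber_of_four_le (f := conflictSecond m) (fun i hi => if_pos hi) (fun i hi => ?_) hj
    simp only [conflictSecond]
    split_ifs <;> omega
  · rw [card_fiber_add_four (f := conflictSecond m) (fun i hi => if_pos hi) (by omega)]
    rcases hj' with rfl | rfl <;> simp [conflictSecond, Fin.ext_iff]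
  · rw [card_fiber_add_four (f := conflictSecond m) (fun i hi => if_pos hi) (by omega)]
    rcases Fin.eq_or_four_le j with rfl | rfl | rfl | rfl | h <;> tauto

theorem conflictFirst_symm_le (i j : Fin (m + 4)) :
    (conflictProfile m i).symm (conflictFirst m i) ≤ (conflictProfile m i).symm j := by
  suffices h : (conflictProfile m i).symm (conflictFirst m i) = 0 by
    rw [h]
    exact Fin.zero_le _
  rcases Fin.eq_or_four_le i with rfl | rfl | rfl | rfl | h
  · simp [conflictProfile_zero_symm, conflictFirst]
  · simp [conflictProfile_one_symm, conflictFirst, Equiv.swap_apply_def, Fin.ext_iff]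
  · simp [conflictProfile_two_symm, conflictFirst, Fin.ext_iff]
  · simp [conflictProfile_three_symm, conflictFirst, Equiv.swap_apply_def, Fin.ext_iff]
  · rw [conflictFirst, if_pos h, conflictProfile_of_four_le h, Equiv.symm_symm,
      Fin.cycleRange_self]

theorem conflictSecond_symm_le {j : Fin (m + 4)} (i : Fin (m + 4)) (h0 : j ≠ 0) (h3 : j ≠ 3) :
    (conflictProfile m i).symm (conflictSecond m i) ≤ (conflictProfile m i).symm j := by
  obtain ⟨h₀, h₁, h₂, h₃⟩ := val_literals_add_four (m := m)
  rw [ne_eq, Fin.ext_iff] at h0 h3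
  rcases Fin.eq_or_four_le i with rfl | rfl | rfl | rfl | h
  · have : conflictSecond m 0 = 1 := by simp [conflictSecond, Fin.ext_iff]
    rw [this]
    simp only [conflictProfile_zero_symm, Fin.le_def]
    omega
  · have : conflictSecond m 1 = 2 := by simp [conflictSecond, Fin.ext_iff]
    rw [this]
    simp only [conflictProfile_one_symm, Equiv.swap_apply_def, Fin.ext_iff, Fin.le_def]
    split_ifs <;> omega
  · have : conflictSecond m 2 = 1 := by simp [conflictSecond, Fin.ext_iff]
    rw [this]
    simp only [conflictProfile_two_symm, Equiv.swap_apply_def, Fin.ext_iff, Fin.le_def]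
    split_ifs <;> omega
  · have : conflictSecond m 3 = 2 := by simp [conflictSecond, Fin.ext_iff]
    rw [this]
    simp only [conflictProfile_three_symm, Equiv.swap_apply_def, Fin.ext_iff, Fin.le_def]
    split_ifs <;> omega
  · have : conflictSecond m i = conflictFirst m i := by
      simp [conflictSecond, conflictFirst, h]
    rw [this]
    exact conflictFirst_symm_le i j

theorem psStep_conflict_zero : psStep (conflictProfile m) 0 =
    fun i j => (0 : Matrix (Fin (m + 4)) (Fin (m + 4)) ℚ) i j +
      if conflictFirst m i = j then 1 / 2 else 0 := by
  have hl (j : Fin (m + 4)) : psLeft (0 : Matrix (Fin (m + 4)) (Fin (m + 4)) ℚ) j = 1 := by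
    simp [psLeft]
  refine psStep_eq (fun i => by rw [hl]; norm_num) (fun i j _ => conflictFirst_symm_le i j)
    (fun i => ?_) (i₀ := 0) ?_
  · rw [hl, card_conflictFirst]
    split_ifs <;> norm_num
  · rw [hl, card_conflictFirst]
    simp [conflictFirst]

theorem psLeft_conflict (j : Fin (m + 4)) :
    psLeft (psStep (conflictProfile m) 0) j =
      if 4 ≤ (j : ℕ) then 1 / 2 else if j = 0 ∨ j = 3 then 0 else 1 := by
  rw [psStep_conflict_zero, psLeft_add, card_conflictFirst]
  simp only [psLeft, Matrix.zero_apply, Finset.sum_const_zero]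
  split_ifs <;> norm_num

theorem psStep_conflict : psStep (conflictProfile m) (psStep (conflictProfile m) 0) =
    fun i j => psStep (conflictProfile m) 0 i j + if conflictSecond m i = j then 1 / 2 else 0 := by
  obtain ⟨h₀, h₁, h₂, h₃⟩ := val_literals_add_four (m := m)
  have hs (i : Fin (m + 4)) : ¬ (conflictSecond m i = 0 ∨ conflictSecond m i = 3) := by
    simp only [conflictSecond, Fin.ext_iff]
    split_ifs <;> omega
  refine psStep_eq (fun i => ?_) (fun i j hj => conflictSecond_symm_le i ?_ ?_)
    (fun i => ?_) (i₀ := 0) ?_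
  · rw [psLeft_conflict, if_neg (hs i)]
    split_ifs <;> norm_num
  · rintro rfl
    simp [psLeft_conflict] at hj
  · rintro rfl
    simp [psLeft_conflict] at hj
  · rw [psLeft_conflict, card_conflictSecond, if_neg (hs i), if_neg (hs i)]
    split_ifs <;> norm_num
  · rw [psLeft_conflict, card_conflictSecond, if_neg (hs 0), if_neg (hs 0)]
    split_ifs <;> norm_num

theorem psMatrix_conflict (i j : Fin (m + 4)) : psMatrix (conflictProfile m) i j =
    (if conflictFirst m i = j then 1 / 2 else 0) + if conflictSecond m i = j then 1 / 2 else 0 := by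
  -- Two phases of length `1/2` consume everything, so the remaining `m + 2` iterations change
  -- nothing.
  have hfix : psStep (conflictProfile m)
      (psStep (conflictProfile m) (psStep (conflictProfile m) 0)) =
      psStep (conflictProfile m) (psStep (conflictProfile m) 0) := by
    refine psStep_eq_self fun j => ?_
    rw [psStep_conflict, psLeft_add, psLeft_conflict, card_conflictSecond]
    split_ifs <;> norm_num
  have hit : (psStep (conflictProfile m))^[m + 4] 0 =
      psStep (conflictProfile m) (psStep (conflictProfile m) 0) :=
    (Function.iterate_add_apply _ (m + 2) 2 _).trans (Function.iterate_fixed hfix _)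
  rw [psMatrix, hit, Matrix.map_apply, psStep_conflict, psStep_conflict_zero]
  simp only [Matrix.zero_apply, zero_add]
  split_ifs <;> norm_num

theorem isConflictMatrix_psMatrix : IsConflictMatrix (psMatrix (conflictProfile m)) := by
  constructor <;> simp [psMatrix_conflict, conflictFirst, conflictSecond, Fin.ext_iff]

end ConflictSerial

/-! ### Impossibility of maximin security -/

section InducedMatrix

variable {n : ℕ} (ρ : PMF (Assignment n))

theorem inducedMatrix_apply (i j : Fin n) :
    inducedMatrix ρ i j = (ρ.expect fun a => if a i = j then 1 else 0).toReal := by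
  rw [PMF.expect, tsum_fintype, ENNReal.toReal_sum fun a _ => ?_]
  · rw [inducedMatrix, Matrix.sum_apply]
    refine Finset.sum_congr rfl fun a _ => ?_
    simp only [Matrix.smul_apply, Equiv.Perm.permMatrix, PEquiv.toMatrix_apply,
      Equiv.toPEquiv_apply, Option.mem_def, Option.some.injEq, smul_eq_mul, ENNReal.toReal_mul]
    split_ifs <;> simp
  · refine ENNReal.mul_ne_top (ρ.apply_ne_top a) ?_
    split_ifs <;> simp

theorem expect_eq_half {i j : Fin n} (h : inducedMatrix ρ i j = 1 / 2) :
    (ρ.expect fun a => if a i = j then 1 else 0) = 2⁻¹ := by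
  rw [inducedMatrix_apply] at h
  have hne : (ρ.expect fun a => if a i = j then 1 else 0) ≠ ∞ := by
    intro htop
    rw [htop] at h
    norm_num at h
  rw [← ENNReal.ofReal_toReal hne, h, ENNReal.ofReal_div_of_pos (by norm_num)]
  simp

theorem inducedMatrix_add_le_one {i i' : Fin n} (hi : i ≠ i') (j : Fin n) :
    inducedMatrix ρ i j + inducedMatrix ρ i' j ≤ 1 := by
  have h : (ρ.expect fun a => if a i = j then 1 else 0) +
      (ρ.expect fun a => if a i' = j then 1 else 0) ≤ 1 := by
    rw [← PMF.expect_add]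
    refine (PMF.expect_mono _ (g := fun _ => 1) fun a => ?_).trans ρ.expect_one.le
    by_cases h₁ : a i = j
    · have h₂ : a i' ≠ j := fun h => hi (a.injective (h₁.trans h.symm))
      simp [h₁, h₂]
    · simp only [h₁, if_false, zero_add]
      split_ifs <;> simp
  have h₁ := ne_top_of_le_ne_top ENNReal.one_ne_top (le_self_add.trans h)
  have h₂ := ne_top_of_le_ne_top ENNReal.one_ne_top (le_add_self.trans h)
  rw [inducedMatrix_apply, inducedMatrix_apply, ← ENNReal.toReal_add h₁ h₂]
  exact ENNReal.toReal_le_of_le_ofReal zero_le_one (by simpa using h)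

/-- The two halves exhaust the total mass, so an assignment giving `i` a third item has no mass
left. -/
theorem eq_or_eq_of_half {i j j' : Fin n} (hj : j ≠ j') (h : inducedMatrix ρ i j = 1 / 2)
    (h' : inducedMatrix ρ i j' = 1 / 2) (a : Assignment n) (ha : ρ a ≠ 0) :
    a i = j ∨ a i = j' := by
  by_contra! hcon
  have key : (ρ.expect fun a => if a i = j then 1 else 0) +
      (ρ.expect fun a => if a i = j' then 1 else 0) +
      (ρ.expect fun b => if b = a then 1 else 0) ≤ 1 := by
    rw [← PMF.expect_add, ← PMF.expect_add]
    refine (PMF.expect_mono _ (g := fun _ => 1) fun b => ?_).trans ρ.expect_one.le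
    by_cases hb : b = a
    · subst hb
      simp [hcon.1, hcon.2]
    · by_cases h₁ : b i = j
      · simp [hb, h₁, hj]
      · simp only [hb, h₁, if_false, zero_add, add_zero]
        split_ifs <;> simp
  rw [expect_eq_half ρ h, expect_eq_half ρ h', ENNReal.inv_two_add_inv_two] at key
  have : (ρ.expect fun b => if b = a then 1 else 0) = ρ a := by
    simp [PMF.expect]
  rw [this] at key
  have h0 := (ENNReal.add_le_add_iff_left ENNReal.one_ne_top).1 (key.trans (add_zero 1).ge)
  exact ha (nonpos_iff_eq_zero.1 h0)

end InducedMatrix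

/-- If two players of a set share their favourite item evenly, then a maximin secure protocol
does not let the players outside that set bias who receives it. -/
theorem Session.MaximinSecure.unbiasable {m t : ℕ} {S : Session.{u} (m + 4)}
    {σ : Profile (m + 4)} (hS : S.MaximinSecure σ t) {C : Finset (Fin (m + 4))} (hC : C.card ≤ t)
    {i i' x : Fin (m + 4)} (hii' : i ≠ i') (hi : i ∉ C) (hi' : i' ∉ C) (hx : σ i 0 = x)
    (hx' : σ i' 0 = x) (h : inducedMatrix S.honest i x = 1 / 2)
    (h' : inducedMatrix S.honest i' x = 1 / 2) :
    S.Unbiasable C fun a => if a i = x then 1 else 0 := by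
  refine ⟨by rw [expect_eq_half _ h]; simp, fun A hA => ?_⟩
  rw [expect_eq_half _ h]
  refine expect_eq_half _ ?_
  have hIic : Finset.Iic (0 : Fin (m + 4)) = {0} := by
    ext k
    simp
  -- Only the first prefix of the dominance order matters: both players keep at least `1/2` of `x`,
  -- and the two shares sum to at most 1.
  have d := hS A (hA ▸ hC) i (hA ▸ hi) 0
  have d' := hS A (hA ▸ hC) i' (hA ▸ hi') 0
  rw [hIic, Finset.sum_singleton, Finset.sum_singleton, hx] at d
  rw [hIic, Finset.sum_singleton, Finset.sum_singleton, hx'] at d'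
  have := inducedMatrix_add_le_one (S.outcome A) hii' x
  linarith

theorem IsConflictMatrix.not_maximinSecure {m t : ℕ} (ht : m + 4 ≤ 2 * t)
    {S : Session.{u} (m + 4)} (hP : IsConflictMatrix (inducedMatrix S.honest)) :
    ¬ S.MaximinSecure (conflictProfile m) t := by
  intro hS
  have ne : (0 : Fin (m + 4)) ≠ 1 ∧ (0 : Fin (m + 4)) ≠ 2 ∧ (0 : Fin (m + 4)) ≠ 3 ∧
      (1 : Fin (m + 4)) ≠ 2 ∧ (1 : Fin (m + 4)) ≠ 3 ∧ (2 : Fin (m + 4)) ≠ 3 := by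
    simp [Fin.ext_iff]
  obtain ⟨n01, n02, n03, n12, n13, n23⟩ := ne
  -- A balanced split separates the two competing pairs; both halves have size at most `t`, also for
  -- odd `n`.
  obtain ⟨C, hC₁, hC₂, hcard⟩ : ∃ C : Finset (Fin (m + 4)), {0, 1} ⊆ C ∧ C ⊆ {2, 3}ᶜ ∧
      C.card = (m + 4) / 2 := by
    refine Finset.exists_subsuperset_card_eq ?_ ?_ ?_
    · intro i hi
      simp only [Finset.mem_insert, Finset.mem_singleton] at hi
      rcases hi with rfl | rfl <;> simp [*]
    · rw [Finset.card_pair n01]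
      omega
    · rw [Finset.card_compl, Finset.card_pair n23, Fintype.card_fin]
      omega
  have c0 : (0 : Fin (m + 4)) ∈ C := hC₁ (by simp)
  have c1 : (1 : Fin (m + 4)) ∈ C := hC₁ (by simp)
  have c2 : (2 : Fin (m + 4)) ∉ C := fun h => by simpa using hC₂ h
  have c3 : (3 : Fin (m + 4)) ∉ C := fun h => by simpa using hC₂ h
  have hφ := hS.unbiasable (C := Cᶜ) (i := 0) (i' := 1) (x := 0)
    (by rw [Finset.card_compl, Fintype.card_fin]; omega) n01 (by simpa) (by simpa)
    rfl (by simp [conflictProfile_one, Equiv.swap_apply_def, n01, n02]) hP.zero_zero hP.one_zero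
  have hψ := hS.unbiasable (C := C) (i := 3) (i' := 2) (x := 3) (by omega) n23.symm c3 c2
    (by simp [conflictProfile_three, Equiv.swap_apply_def, n01, n02])
    (by simp [conflictProfile_two]) hP.three_three hP.two_three
  have key := S.expect_mul_of_unbiasable C hφ hψ
  -- On the support the first event implies the second, so the product is the first indicator and
  -- `key` becomes `1/2 = 1/2 * 1/2`.
  rw [S.honest.expect_congr (g := fun a => if a 0 = 0 then 1 else 0),
    expect_eq_half _ hP.zero_zero, expect_eq_half _ hP.three_three] at key
  · have := congrArg ENNReal.toReal key
    norm_num at this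
  · intro a ha
    by_cases h0 : a 0 = 0
    · have h1 : a 1 = 2 := by
        refine (eq_or_eq_of_half _ n02 hP.one_zero hP.one_two a ha).resolve_left fun h => ?_
        exact n01 (a.injective (h0.trans h.symm))
      have h3 : a 3 = 3 := by
        refine (eq_or_eq_of_half _ n23.symm hP.three_three hP.three_two a ha).resolve_right
          fun h => ?_
        exact n13 (a.injective (h1.trans h.symm))
      simp [h0, h3]
    · simp [h0]

theorem theorem1 (n t : ℕ) (hn : 4 ≤ n) (ht : n ≤ 2 * t) :
    (∀ F : Mechanism n, F.OrdinallyEfficient → F.StrongEqualTreatment →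
      ¬ ∃ prot : Protocol.{u} n, prot.Realizes F ∧ prot.MaximinSecure t) ∧
    (∀ F : Mechanism n, F.IsPS →
      ¬ ∃ prot : Protocol.{u} n, prot.Realizes F ∧ prot.MaximinSecure t) ∧
    (∃ σ : Profile n, ∀ S : Session.{u} n,
      OrdEfficient σ (inducedMatrix S.honest) → StrongEqualTreat σ (inducedMatrix S.honest) →
        ¬ S.MaximinSecure σ t) := by
  obtain ⟨m, rfl⟩ := Nat.exists_eq_add_of_le' hn
  refine ⟨?_, ?_, conflictProfile m, fun S hE hT => (hE.isConflictMatrix hT).not_maximinSecure ht⟩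
  · rintro F hE hT ⟨prot, hF, hS⟩
    have hE := hE (conflictProfile m)
    have hT := hT (conflictProfile m)
    rw [← hF] at hE hT
    exact (hE.isConflictMatrix hT).not_maximinSecure ht (hS _)
  · rintro F hPS ⟨prot, hF, hS⟩
    have hP := isConflictMatrix_psMatrix (m := m)
    rw [← hPS, ← hF] at hP
    exact hP.not_maximinSecure ht (hS _)
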